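/- Let $(M,J,g)$ be an almost Norden manifold, i.e. a smooth $2n$-dimensional manifold with an almost complex structure $J$ and a pseudo-Riemannian metric $g$ such that $g(JX,JY)=-g(X,Y)$; let $\nabla$ be the Levi-Civita connection of $g$ and $R(X,Y)Z=\nabla_X\nabla_YZ-\nabla_Y\nabla_XZ-\nabla_{[X,Y]}Z$ its curvature. Denote by $X^H,X^V$ the horizontal (with respect to $\nabla$) and vertical lifts to $TM$. Let $\hat g$ be the complete lift of $g$ to $TM$, given by $\hat g(X^H,Y^H)=\hat g(X^V,Y^V)=0$ and $\hat g(X^H,Y^V)=\hat g(X^V,Y^H)=g(X,Y)$, and let $J_1X^H=-(JX)^H$, $J_1X^V=(JX)^V$, $J_2X^H=X^V$, $J_2X^V=-X^H$, $J_3=J_1J_2$. For a non-degenerate plane with basis $x,y$ write $\pi_1(x,y,y,x)=g(x,x)g(y,y)-g(x,y)^2$, $k(x,y)=g(R(x,y)y,x)/\pi_1(x,y,y,x)$ and $(\nabla_uk)(x,y)=g((\nabla_uR)(x,y)y,x)/\pi_1(x,y,y,x)$, and let $\hat k$ denote the sectional curvature of $\hat g$. A plane $\beta$ is $J_\alpha$-holomorphic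 if $J_\alpha\beta=\beta$. Let $p\in M$, $u\in T_pM$, and let $\{e_i,e_{\bar i}\}_{i=1}^n$ be a basis of $T_pM$ with $e_{\bar i}=Je_i$ which is orthonormal for $g$ (the vectors are mutually orthogonal and $g(e_a,e_a)=\pm1$). For $a\in\{1,\dots,n,\bar1,\dots,\bar n\}$ put $\xi_a=\frac1{\sqrt2}(e_a^H+e_a^V)$ and $\eta_a=\frac1{\sqrt2}(e_a^H-e_a^V)$ in $T_u(TM)$; the planes spanned by two distinct vectors of $\{\xi_a,\eta_a\}$ are called basic. Then every basic plane is non-degenerate with respect to $\hat g$, and: (i) for all $a\neq b$, $$\hat k(\xi_a,\xi_b)=\tfrac14(\nabla_uk)(e_a,e_b)+k(e_a,e_b),\quad \hat k(\xi_a,\eta_b)=-\tfrac14(\nabla_uk)(e_a,e_b),\quad \hat k(\eta_a,\eta_b)=\tfrac14(\nabla_uk)(e_a,e_b)-k(e_a,e_b);$$ (ii) the $J_1$-holomorphic basic planes are exactly $\{\xi_{\bar i},\eta_i\}$ and $\{\eta_{\bar i},\xi_i\}$, $1\le i\le n$, and for each $i$ they have equal sectional curvatures, $\hat k(\xi_{\bar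 i},\eta_i)=\hat k(\eta_{\bar i},\xi_i)$; (iii) the $J_2$-holomorphic basic planes are exactly $\{\eta_i,\xi_i\}$ and $\{\eta_{\bar i},\xi_{\bar i}\}$, $1\le i\le n$, and their sectional curvatures vanish. -/

import Mathlib

open scoped Manifold ContDiff
open Bundle

noncomputable section

namespace Norden

/-! ### Pseudo-Riemannian geometry in a coordinate domain

`G : E → E →L[ℝ] E →L[ℝ] ℝ` is the coordinate expression of a metric. -/

section Coordinates

variable {E : Type*} [NormedAddCommGroup E] [NormedSpace ℝ E]

/-- The trilinear form `(v, w, z) ↦ D z v w`. -/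
def cycle (D : E →L[ℝ] E →L[ℝ] E →L[ℝ] ℝ) : E →L[ℝ] E →L[ℝ] E →L[ℝ] ℝ :=
  ((ContinuousLinearMap.flipₗᵢ ℝ E E ℝ : (E →L[ℝ] E →L[ℝ] ℝ) ≃ₗᵢ[ℝ] (E →L[ℝ] E →L[ℝ] ℝ)) :
    (E →L[ℝ] E →L[ℝ] ℝ) →L[ℝ] (E →L[ℝ] E →L[ℝ] ℝ)) ∘L D.flip

theorem cycle_apply (D : E →L[ℝ] E →L[ℝ] E →L[ℝ] ℝ) (v w z : E) : cycle D v w z = D z v w := rfl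

set_option maxSynthPendingDepth 3 in
/-- The Christoffel symbols of the first kind of `G` at `y`:
`(v, w, z) ↦ (1/2) (∂_v G(w,z) + ∂_w G(v,z) - ∂_z G(v,w))`. -/
def christoffelFirst (G : E → E →L[ℝ] E →L[ℝ] ℝ) (y : E) : E →L[ℝ] E →L[ℝ] E →L[ℝ] ℝ :=
  (1 / 2 : ℝ) • (fderiv ℝ G y + (fderiv ℝ G y).flip - cycle (fderiv ℝ G y))

set_option maxSynthPendingDepth 3 in
theorem christoffelFirst_apply (G : E → E →L[ℝ] E →L[ℝ] ℝ) (y v w z : E) :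
    christoffelFirst G y v w z =
      (1 / 2) * (fderiv ℝ G y v w z + fderiv ℝ G y w v z - fderiv ℝ G y z v w) := by
  simp [christoffelFirst, cycle_apply]

/-- The Christoffel symbols of the second kind of `G` at `y`, that is, the Levi-Civita connection
in coordinates: `christoffel G y v w` is the covariant derivative along `v` of the constant field
`w`. The first symbols are raised with the inverse of `G y : E →L[ℝ] (E →L[ℝ] ℝ)`. -/
def christoffel (G : E → E →L[ℝ] E →L[ℝ] ℝ) (y : E) : E →L[ℝ] E →L[ℝ] E :=
  (ContinuousLinearMap.compL ℝ E (E →L[ℝ] ℝ) E (G y).inverse) ∘L christoffelFirst G y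

theorem christoffel_apply (G : E → E →L[ℝ] E →L[ℝ] ℝ) (y v w : E) :
    christoffel G y v w = (G y).inverse (christoffelFirst G y v w) := rfl

/-- The curvature `R(a,b)c = ∇_a ∇_b c - ∇_b ∇_a c - ∇_[a,b] c` of the Levi-Civita connection of
`G` in coordinates (`a`, `b`, `c` are constant fields, so that `[a,b] = 0`). -/
def riemann (G : E → E →L[ℝ] E →L[ℝ] ℝ) (y a b c : E) : E :=
  fderiv ℝ (fun y' => christoffel G y' b c) y a - fderiv ℝ (fun y' => christoffel G y' a c) y b
    + christoffel G y a (christoffel G y b c) - christoffel G y b (christoffel G y a c)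

/-- The covariant derivative `(∇_u R)(a,b)c` of the curvature tensor in coordinates. -/
def nablaRiemann (G : E → E →L[ℝ] E →L[ℝ] ℝ) (y u a b c : E) : E :=
  fderiv ℝ (fun y' => riemann G y' a b c) y u + christoffel G y u (riemann G y a b c)
    - riemann G y (christoffel G y u a) b c - riemann G y a (christoffel G y u b) c
    - riemann G y a b (christoffel G y u c)

end Coordinates

/-- The bilinear form `(v, w) ↦ B (S v) (T w)`. -/
def pullForm {V W : Type*} [AddCommGroup V] [Module ℝ V] [TopologicalSpace V]
    [IsTopologicalAddGroup V] [ContinuousSMul ℝ V] [AddCommGroup W] [Module ℝ W]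
    [TopologicalSpace W] [IsTopologicalAddGroup W] [ContinuousSMul ℝ W]
    (B : W →L[ℝ] W →L[ℝ] ℝ) (S T : V →L[ℝ] W) : V →L[ℝ] V →L[ℝ] ℝ :=
  ContinuousLinearMap.precomp ℝ T ∘L B ∘L S

/-! ### Pseudo-Riemannian geometry on a manifold -/

section Manifold

variable {E : Type*} [NormedAddCommGroup E] [NormedSpace ℝ E]
  {H : Type*} [TopologicalSpace H] (I : ModelWithCorners ℝ E H)
  (M : Type*) [TopologicalSpace M] [ChartedSpace H M]

/-- A field of bilinear forms on the tangent spaces of `M`. -/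
abbrev FormField : Type _ := ∀ x : M, TangentSpace I x →L[ℝ] TangentSpace I x →L[ℝ] ℝ

/-- A field of endomorphisms of the tangent spaces of `M`. -/
abbrev EndField : Type _ := ∀ x : M, TangentSpace I x →L[ℝ] TangentSpace I x

/-- A smooth pseudo-Riemannian metric. -/
structure IsPseudoRiemannianMetric [IsManifold I ∞ M] (g : FormField I M) : Prop where
  symm : ∀ (x : M) (v w : TangentSpace I x), g x v w = g x w v
  nondegenerate : ∀ (x : M) (v : TangentSpace I x), (∀ w : TangentSpace I x, g x v w = 0) → v = 0
  contMDiff : ContMDiff I (I.prod 𝓘(ℝ, E →L[ℝ] E →L[ℝ] ℝ)) ∞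
    (fun x => TotalSpace.mk' (E →L[ℝ] E →L[ℝ] ℝ) (E := fun x : M =>
      TangentSpace I x →L[ℝ] TangentSpace I x →L[ℝ] ℝ) x (g x))

/-- A smooth almost complex structure. -/
structure IsAlmostComplexStructure [IsManifold I ∞ M] (J : EndField I M) : Prop where
  sq : ∀ (x : M) (v : TangentSpace I x), J x (J x v) = -v
  contMDiff : ContMDiff I (I.prod 𝓘(ℝ, E →L[ℝ] E)) ∞
    (fun x => TotalSpace.mk' (E →L[ℝ] E) (E := fun x : M =>
      TangentSpace I x →L[ℝ] TangentSpace I x) x (J x))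

/-- `(M, J, g)` is an almost Norden manifold: `J` acts as an anti-isometry of `g`. -/
structure IsAlmostNorden [IsManifold I ∞ M] (J : EndField I M) (g : FormField I M) : Prop where
  metric : IsPseudoRiemannianMetric I M g
  almostComplex : IsAlmostComplexStructure I M J
  antiIsometry : ∀ (x : M) (v w : TangentSpace I x), g x (J x v) (J x w) = -g x v w

variable {I M} [IsManifold I 1 M]

/-- The components of `g` in the preferred chart at `x₀`, as a function on the model space. -/
def inChart (g : FormField I M) (x₀ : M) (y : E) : E →L[ℝ] E →L[ℝ] ℝ :=
  pullForm (g ((extChartAt I x₀).symm y))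
    ((trivializationAt E (TangentSpace I : M → Type _) x₀).symmL ℝ ((extChartAt I x₀).symm y))
    ((trivializationAt E (TangentSpace I : M → Type _) x₀).symmL ℝ ((extChartAt I x₀).symm y))

/-- The Christoffel symbols of `g` at `x` in the preferred chart at `x`. (In Mathlib
`TangentSpace I x` is the model space `E`, identified through the preferred chart at `x`.) -/
def christoffelAt (g : FormField I M) (x : M) :
    TangentSpace I x →L[ℝ] TangentSpace I x →L[ℝ] TangentSpace I x :=
  christoffel (E := E) (inChart g x) (extChartAt I x x)

/-- The curvature tensor `R(a,b)c` of the Levi-Civita connection of `g` at `x`. -/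
def curvature (g : FormField I M) (x : M) (a b c : TangentSpace I x) : TangentSpace I x :=
  riemann (E := E) (inChart g x) (extChartAt I x x) a b c

/-- The covariant derivative `(∇_u R)(a,b)c` at `x`. -/
def nablaCurvature (g : FormField I M) (x : M) (u a b c : TangentSpace I x) : TangentSpace I x :=
  nablaRiemann (E := E) (inChart g x) (extChartAt I x x) u a b c

/-- `π₁(a,b,b,a) = g(a,a) g(b,b) - g(a,b)²`; the plane spanned by `a`, `b` is non-degenerate if
and only if this is non-zero. -/
def gram (g : FormField I M) (x : M) (a b : TangentSpace I x) : ℝ :=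
  g x b b * g x a a - g x a b * g x b a

/-- The sectional curvature `R(a,b,b,a) / π₁(a,b,b,a)` of the plane spanned by `a`, `b`, where
`R(a,b,c,d) = g(R(a,b)c,d)`. -/
def sectional (g : FormField I M) (x : M) (a b : TangentSpace I x) : ℝ :=
  g x (curvature g x a b b) a / gram g x a b

/-- `∇_u k`, the covariant derivative of the sectional curvature:
`(∇_u R)(a,b,b,a) / π₁(a,b,b,a)` (recall `∇ π₁ = 0`). -/
def nablaSectional (g : FormField I M) (x : M) (u a b : TangentSpace I x) : ℝ :=
  g x (nablaCurvature g x u a b b) a / gram g x a b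

end Manifold

/-- A subspace `β` is `J`-holomorphic if `J β = β`. -/
def IsHolomorphic {V : Type*} [AddCommGroup V] [Module ℝ V] [TopologicalSpace V]
    (J : V →L[ℝ] V) (β : Submodule ℝ V) : Prop :=
  β.map (J : V →ₗ[ℝ] V) = β

/-! ### The tangent bundle

The preferred chart of `TM` at `u ∈ T_pM` is the one induced by the preferred chart of `M` at `p`,
so that `T_u(TM)` is `E × E`: base components first, fibre components second. -/

section TangentBundle

variable {E : Type*} [NormedAddCommGroup E] [NormedSpace ℝ E]
  {H : Type*} [TopologicalSpace H] {I : ModelWithCorners ℝ E H}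
  {M : Type*} [TopologicalSpace M] [ChartedSpace H M] [IsManifold I 1 M]

/-- The differential of the projection `TM → M` at `u`. -/
def dproj (u : TangentBundle I M) : TangentSpace I.tangent u →L[ℝ] TangentSpace I u.proj :=
  ContinuousLinearMap.fst ℝ E E

/-- The vertical lift `X ↦ X^V = X^k ∂/∂y^k` at `u`. -/
def vLift (u : TangentBundle I M) : TangentSpace I u.proj →L[ℝ] TangentSpace I.tangent u :=
  ContinuousLinearMap.inr ℝ E E

/-- The field `X^k ∂/∂x^k` at `u`. -/
def baseLift (u : TangentBundle I M) : TangentSpace I u.proj →L[ℝ] TangentSpace I.tangent u :=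
  ContinuousLinearMap.inl ℝ E E

/-- The components `ξ ↦ (dy^k(ξ))_k` of `ξ ∈ T_u(TM)`. -/
def fibrePart (u : TangentBundle I M) : TangentSpace I.tangent u →L[ℝ] TangentSpace I u.proj :=
  ContinuousLinearMap.snd ℝ E E

/-- The horizontal lift `X ↦ X^H = X^k ∂/∂x^k - Γ^k_{ij} u^i X^j ∂/∂y^k` at `u` with respect to the
Levi-Civita connection of `g`. -/
def hLift (g : FormField I M) (u : TangentBundle I M) :
    TangentSpace I u.proj →L[ℝ] TangentSpace I.tangent u :=
  baseLift u - vLift u ∘L christoffelAt g u.proj u.snd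

/-- The connection map at `u`, characterized by `ξ = (dproj ξ)^H + (connector ξ)^V`. -/
def connector (g : FormField I M) (u : TangentBundle I M) :
    TangentSpace I.tangent u →L[ℝ] TangentSpace I u.proj :=
  fibrePart u + christoffelAt g u.proj u.snd ∘L dproj u

theorem dproj_hLift (g : FormField I M) (u : TangentBundle I M) (X : TangentSpace I u.proj) :
    dproj u (hLift g u X) = X := by
  have h₁ : dproj u (baseLift u X) = X := rfl
  have h₂ : dproj u (vLift u (christoffelAt g u.proj u.snd X)) = 0 := rfl
  simp [hLift, h₁, h₂]

theorem dproj_vLift (u : TangentBundle I M) (X : TangentSpace I u.proj) :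
    dproj u (vLift u X) = 0 := rfl

theorem connector_hLift (g : FormField I M) (u : TangentBundle I M) (X : TangentSpace I u.proj) :
    connector g u (hLift g u X) = 0 := by
  have h₁ : fibrePart u (baseLift u X) = 0 := rfl
  have h₂ : fibrePart u (vLift u (christoffelAt g u.proj u.snd X)) =
    christoffelAt g u.proj u.snd X := rfl
  have h₃ : connector g u (hLift g u X) = fibrePart u (hLift g u X) +
    christoffelAt g u.proj u.snd (dproj u (hLift g u X)) := rfl
  rw [h₃, dproj_hLift]
  simp [hLift, h₁, h₂]

theorem connector_vLift (g : FormField I M) (u : TangentBundle I M) (X : TangentSpace I u.proj) :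
    connector g u (vLift u X) = X := by
  have h₁ : fibrePart u (vLift u X) = X := rfl
  simp [connector, h₁, dproj_vLift]

theorem hLift_dproj_add_vLift_connector (g : FormField I M) (u : TangentBundle I M)
    (ξ : TangentSpace I.tangent u) :
    hLift g u (dproj u ξ) + vLift u (connector g u ξ) = ξ := by
  have h : baseLift u (dproj u ξ) + vLift u (fibrePart u ξ) = ξ :=
    Prod.ext (add_zero (ξ : E × E).1) (zero_add (ξ : E × E).2)
  have h₂ : hLift g u (dproj u ξ) = baseLift u (dproj u ξ) -
    vLift u (christoffelAt g u.proj u.snd (dproj u ξ)) := rfl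
  have h₃ : connector g u ξ = fibrePart u ξ + christoffelAt g u.proj u.snd (dproj u ξ) := rfl
  rw [h₂, h₃, map_add]
  refine Eq.trans ?_ h
  abel

/-- The complete lift metric `ĝ` on `TM`: the lifts satisfy `ĝ(X^H,Y^H) = ĝ(X^V,Y^V) = 0` and
`ĝ(X^H,Y^V) = ĝ(X^V,Y^H) = g(X,Y)`. -/
def completeLift (g : FormField I M) : FormField I.tangent (TangentBundle I M) := fun u =>
  pullForm (g u.proj) (dproj u) (connector g u) + pullForm (g u.proj) (connector g u) (dproj u)

theorem completeLift_apply (g : FormField I M) (u : TangentBundle I M)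
    (ξ ζ : TangentSpace I.tangent u) : completeLift g u ξ ζ =
      g u.proj (dproj u ξ) (connector g u ζ) + g u.proj (connector g u ξ) (dproj u ζ) := rfl

theorem completeLift_hLift_vLift (g : FormField I M) (u : TangentBundle I M)
    (X Y : TangentSpace I u.proj) : completeLift g u (hLift g u X) (vLift u Y) = g u.proj X Y := by
  simp [completeLift_apply, dproj_hLift, dproj_vLift, connector_hLift, connector_vLift]

theorem completeLift_vLift_hLift (g : FormField I M) (u : TangentBundle I M)
    (X Y : TangentSpace I u.proj) : completeLift g u (vLift u X) (hLift g u Y) = g u.proj X Y := by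
  simp [completeLift_apply, dproj_hLift, dproj_vLift, connector_hLift, connector_vLift]

theorem completeLift_hLift_hLift (g : FormField I M) (u : TangentBundle I M)
    (X Y : TangentSpace I u.proj) : completeLift g u (hLift g u X) (hLift g u Y) = 0 := by
  simp [completeLift_apply, connector_hLift]

theorem completeLift_vLift_vLift (g : FormField I M) (u : TangentBundle I M)
    (X Y : TangentSpace I u.proj) : completeLift g u (vLift u X) (vLift u Y) = 0 := by
  simp [completeLift_apply, dproj_vLift]

/-- `J₁ : X^H ↦ -(JX)^H, X^V ↦ (JX)^V`. -/
def J₁ (J : EndField I M) (g : FormField I M) : EndField I.tangent (TangentBundle I M) := fun u =>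
  -(hLift g u ∘L J u.proj ∘L dproj u) + vLift u ∘L J u.proj ∘L connector g u

/-- `J₂ : X^H ↦ X^V, X^V ↦ -X^H`. -/
def J₂ (g : FormField I M) : EndField I.tangent (TangentBundle I M) := fun u =>
  vLift u ∘L dproj u - hLift g u ∘L connector g u

theorem J₁_lifts (J : EndField I M) (g : FormField I M) (u : TangentBundle I M)
    (X : TangentSpace I u.proj) :
    J₁ J g u (hLift g u X) = -hLift g u (J u.proj X) ∧
      J₁ J g u (vLift u X) = vLift u (J u.proj X) := by
  simp [J₁, dproj_hLift, dproj_vLift, connector_hLift, connector_vLift]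

theorem J₂_lifts (g : FormField I M) (u : TangentBundle I M) (X : TangentSpace I u.proj) :
    J₂ g u (hLift g u X) = vLift u X ∧ J₂ g u (vLift u X) = -hLift g u X := by
  simp [J₂, dproj_hLift, dproj_vLift, connector_hLift, connector_vLift]

/-- `J₃ : X^H ↦ (JX)^V, X^V ↦ (JX)^H`. -/
def J₃ (J : EndField I M) (g : FormField I M) : EndField I.tangent (TangentBundle I M) := fun u =>
  vLift u ∘L J u.proj ∘L dproj u + hLift g u ∘L J u.proj ∘L connector g u

theorem J₃_lifts (J : EndField I M) (g : FormField I M) (u : TangentBundle I M)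
    (X : TangentSpace I u.proj) :
    J₃ J g u (hLift g u X) = vLift u (J u.proj X) ∧
      J₃ J g u (vLift u X) = hLift g u (J u.proj X) := by
  simp [J₃, dproj_hLift, dproj_vLift, connector_hLift, connector_vLift]

/-- An orthonormal `J`-basis of `T_pM`: `e (inl i) = e_i` and `e (inr i) = e_{ī} = J e_i`. -/
structure IsOrthonormalJBasis {n : ℕ} (J : EndField I M) (g : FormField I M) (p : M)
    (e : Module.Basis (Fin n ⊕ Fin n) ℝ (TangentSpace I p)) : Prop where
  bar : ∀ i, e (Sum.inr i) = J p (e (Sum.inl i))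
  orthogonal : ∀ a b, a ≠ b → g p (e a) (e b) = 0
  normalized : ∀ a, g p (e a) (e a) = 1 ∨ g p (e a) (e a) = -1

/-- `ξ = (X^H + X^V) / √2`. -/
def xi (g : FormField I M) (u : TangentBundle I M) (X : TangentSpace I u.proj) :
    TangentSpace I.tangent u :=
  (1 / √2 : ℝ) • (hLift g u X + vLift u X)

/-- `η = (X^H - X^V) / √2`. -/
def eta (g : FormField I M) (u : TangentBundle I M) (X : TangentSpace I u.proj) :
    TangentSpace I.tangent u :=
  (1 / √2 : ℝ) • (hLift g u X - vLift u X)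

/-- The adapted `H`-basis of `T_u(TM)`: `inl a ↦ ξ_a`, `inr a ↦ η_a`, where the index `a` is
`inl i` for `i` and `inr i` for `ī`. -/
def adapted {n : ℕ} (g : FormField I M) (u : TangentBundle I M)
    (e : Module.Basis (Fin n ⊕ Fin n) ℝ (TangentSpace I u.proj)) :
    (Fin n ⊕ Fin n) ⊕ (Fin n ⊕ Fin n) → TangentSpace I.tangent u :=
  Sum.elim (fun a => xi g u (e a)) (fun a => eta g u (e a))

/-- The basic 2-plane spanned by the vectors of the adapted `H`-basis with indices `A`, `B`. -/
def basicPlane {n : ℕ} (g : FormField I M) (u : TangentBundle I M)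
    (e : Module.Basis (Fin n ⊕ Fin n) ℝ (TangentSpace I u.proj))
    (A B : (Fin n ⊕ Fin n) ⊕ (Fin n ⊕ Fin n)) : Submodule ℝ (TangentSpace I.tangent u) :=
  Submodule.span ℝ {adapted g u e A, adapted g u e B}

end TangentBundle

end Norden

end

noncomputable section

set_option maxSynthPendingDepth 3

namespace Norden

section Coordinates

variable {E : Type*} [NormedAddCommGroup E] [NormedSpace ℝ E]

theorem pullForm_apply {V W : Type*} [AddCommGroup V] [Module ℝ V] [TopologicalSpace V]
    [IsTopologicalAddGroup V] [ContinuousSMul ℝ V] [AddCommGroup W] [Module ℝ W]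
    [TopologicalSpace W] [IsTopologicalAddGroup W] [ContinuousSMul ℝ W]
    (B : W →L[ℝ] W →L[ℝ] ℝ) (S T : V →L[ℝ] W) (v w : V) :
    pullForm B S T v w = B (S v) (T w) := rfl

/-- The complete lift of `G` to `E × E`, in coordinates. -/
def tangentForm (G : E → E →L[ℝ] E →L[ℝ] ℝ) (p : E × E) : E × E →L[ℝ] E × E →L[ℝ] ℝ :=
  pullForm (fderiv ℝ G p.1 p.2) (.fst ℝ E E) (.fst ℝ E E)
    + pullForm (G p.1) (.fst ℝ E E) (.snd ℝ E E) + pullForm (G p.1) (.snd ℝ E E) (.fst ℝ E E)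

theorem tangentForm_apply (G : E → E →L[ℝ] E →L[ℝ] ℝ) (p A B : E × E) :
    tangentForm G p A B =
      fderiv ℝ G p.1 p.2 A.1 B.1 + G p.1 A.1 B.2 + G p.1 A.2 B.1 := rfl

/-- A smooth field of nondegenerate symmetric forms on an open set. -/
structure IsMetricOn (G : E → E →L[ℝ] E →L[ℝ] ℝ) (U : Set E) : Prop where
  isOpen : IsOpen U
  contDiffOn : ContDiffOn ℝ ∞ G U
  symm : ∀ y ∈ U, ∀ v w, G y v w = G y w v
  nondegenerate : ∀ y ∈ U, ∀ v, (∀ w, G y v w = 0) → v = 0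

theorem hasFDerivAt_fderiv_apply {W : Type*} [NormedAddCommGroup W] [NormedSpace ℝ W]
    {F : E → W} {p : E × E} (hF : ContDiffAt ℝ ∞ F p.1) :
    HasFDerivAt (fun q : E × E => fderiv ℝ F q.1 q.2)
      ((fderiv ℝ F p.1) ∘L .snd ℝ E E
        + (((fderiv ℝ (fderiv ℝ F) p.1) ∘L .fst ℝ E E).flip p.2)) p := by
  have h : DifferentiableAt ℝ (fderiv ℝ F) p.1 :=
    (hF.fderiv_right (m := ∞) (by simp)).differentiableAt (by simp)
  exact (h.hasFDerivAt.comp p hasFDerivAt_fst).clm_apply hasFDerivAt_snd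

theorem fderiv_fderiv_comm {W : Type*} [NormedAddCommGroup W] [NormedSpace ℝ W]
    {F : E → W} {y : E} (hF : ContDiffAt ℝ ∞ F y) (a b : E) :
    fderiv ℝ (fderiv ℝ F) y a b = fderiv ℝ (fderiv ℝ F) y b a :=
  (hF.isSymmSndFDerivAt (by simpa using ENat.LEInfty.out)).eq a b

theorem fderiv_apply₂ {V W X : Type*} [NormedAddCommGroup V] [NormedSpace ℝ V]
    [NormedAddCommGroup W] [NormedSpace ℝ W] [NormedAddCommGroup X] [NormedSpace ℝ X]
    {F : E → V →L[ℝ] W →L[ℝ] X} {y : E} (hF : DifferentiableAt ℝ F y) (a : E) (v : V) (w : W) :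
    fderiv ℝ (fun y' => F y' v w) y a = fderiv ℝ F y a v w := by
  have := ((hF.hasFDerivAt.clm_apply (hasFDerivAt_const v y)).clm_apply (hasFDerivAt_const w y))
  rw [this.fderiv]
  simp

namespace IsMetricOn

variable {G : E → E →L[ℝ] E →L[ℝ] ℝ} {U : Set E} {y : E}

theorem contDiffAt (hG : IsMetricOn G U) (hy : y ∈ U) : ContDiffAt ℝ ∞ G y :=
  hG.contDiffOn.contDiffAt (hG.isOpen.mem_nhds hy)

theorem differentiableAt (hG : IsMetricOn G U) (hy : y ∈ U) : DifferentiableAt ℝ G y :=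
  (hG.contDiffAt hy).differentiableAt (by simp)

theorem fderiv_symm (hG : IsMetricOn G U) (hy : y ∈ U) (a v w : E) :
    fderiv ℝ G y a v w = fderiv ℝ G y a w v := by
  rw [← fderiv_apply₂ (hG.differentiableAt hy), ← fderiv_apply₂ (hG.differentiableAt hy)]
  congr 1
  apply Filter.EventuallyEq.fderiv_eq
  filter_upwards [hG.isOpen.mem_nhds hy] with z hz using hG.symm z hz v w

variable [FiniteDimensional ℝ E]

theorem exists_equiv (hG : IsMetricOn G U) (hy : y ∈ U) :
    ∃ e : E ≃L[ℝ] (E →L[ℝ] ℝ), (e : E →L[ℝ] E →L[ℝ] ℝ) = G y := by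
  have hinj : Function.Injective (G y : E →ₗ[ℝ] E →L[ℝ] ℝ) := by
    rw [← LinearMap.ker_eq_bot, LinearMap.ker_eq_bot']
    intro v hv
    exact hG.nondegenerate y hy v fun w => by
      have := congrArg (fun f : E →L[ℝ] ℝ => f w) hv
      simpa using this
  have hdim : Module.finrank ℝ E = Module.finrank ℝ (E →L[ℝ] ℝ) := by
    rw [← (LinearMap.toContinuousLinearMap : (E →ₗ[ℝ] ℝ) ≃ₗ[ℝ] _).finrank_eq]
    exact Subspace.dual_finrank_eq.symm
  exact ⟨(LinearEquiv.ofInjectiveOfFinrankEq (G y : E →ₗ[ℝ] E →L[ℝ] ℝ) hinj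
    hdim).toContinuousLinearEquiv, rfl⟩

theorem apply_christoffel (hG : IsMetricOn G U) (hy : y ∈ U) (v w : E) :
    G y (christoffel G y v w) = christoffelFirst G y v w := by
  obtain ⟨e, he⟩ := hG.exists_equiv hy
  rw [christoffel_apply, ← he, ContinuousLinearMap.inverse_equiv]
  simp

theorem eq_christoffel (hG : IsMetricOn G U) (hy : y ∈ U) {v w t : E}
    (h : ∀ z, G y t z = christoffelFirst G y v w z) : christoffel G y v w = t := by
  rw [← sub_eq_zero]
  refine hG.nondegenerate y hy _ fun z => ?_
  rw [map_sub, sub_apply, h, hG.apply_christoffel hy, sub_self]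

/-- The Levi-Civita connection is metric. -/
theorem fderiv_eq_christoffel (hG : IsMetricOn G U) (hy : y ∈ U) (u v w : E) :
    fderiv ℝ G y u v w = G y v (christoffel G y u w) + G y (christoffel G y u v) w := by
  rw [hG.symm y hy v, hG.apply_christoffel hy, hG.apply_christoffel hy, christoffelFirst_apply,
    christoffelFirst_apply, hG.fderiv_symm hy u w v, hG.fderiv_symm hy w u v,
    hG.fderiv_symm hy v u w]
  ring

theorem contDiffOn_christoffel (hG : IsMetricOn G U) : ContDiffOn ℝ ∞ (christoffel G) U := by
  have : CompleteSpace E := FiniteDimensional.complete ℝ E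
  rw [contDiffOn_clm_apply]
  intro v
  rw [contDiffOn_clm_apply]
  intro w z hz
  have hinv : ContDiffAt ℝ ∞ (fun x => (G x).inverse) z := by
    obtain ⟨e, he⟩ := hG.exists_equiv hz
    have := contDiffAt_map_inverse (𝕜 := ℝ) (n := ∞) e
    rw [he] at this
    exact this.comp z (hG.contDiffAt hz)
  have hD : ContDiffOn ℝ ∞ (fderiv ℝ G) U :=
    hG.contDiffOn.fderiv_of_isOpen hG.isOpen (m := ∞) (by simp)
  have hfirst : ContDiffOn ℝ ∞ (fun x => christoffelFirst G x v w) U := by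
    rw [contDiffOn_clm_apply]
    intro t
    simp only [christoffelFirst_apply]
    have h (a b c : E) : ContDiffOn ℝ ∞ (fun x => fderiv ℝ G x a b c) U :=
      ((hD.clm_apply contDiffOn_const).clm_apply contDiffOn_const).clm_apply contDiffOn_const
    exact contDiffOn_const.mul (((h v w t).add (h w v t)).sub (h t v w))
  exact (hinv.clm_apply (hfirst.contDiffAt (hG.isOpen.mem_nhds hz))).contDiffWithinAt

theorem contDiffAt_christoffel (hG : IsMetricOn G U) (hy : y ∈ U) :
    ContDiffAt ℝ ∞ (christoffel G) y :=
  hG.contDiffOn_christoffel.contDiffAt (hG.isOpen.mem_nhds hy)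

theorem differentiableAt_christoffel (hG : IsMetricOn G U) (hy : y ∈ U) :
    DifferentiableAt ℝ (christoffel G) y :=
  (hG.contDiffAt_christoffel hy).differentiableAt (by simp)

theorem riemann_eq (hG : IsMetricOn G U) (hy : y ∈ U) (a b c : E) :
    riemann G y a b c = fderiv ℝ (christoffel G) y a b c - fderiv ℝ (christoffel G) y b a c
      + christoffel G y a (christoffel G y b c) - christoffel G y b (christoffel G y a c) := by
  rw [riemann, fderiv_apply₂ (hG.differentiableAt_christoffel hy),
    fderiv_apply₂ (hG.differentiableAt_christoffel hy)]


theorem tangentForm (hG : IsMetricOn G U) :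
    IsMetricOn (tangentForm G) (U ×ˢ (Set.univ : Set E)) where
  isOpen := hG.isOpen.prod isOpen_univ
  contDiffOn := by
    rw [contDiffOn_clm_apply]
    intro A
    rw [contDiffOn_clm_apply]
    intro B
    simp only [tangentForm_apply]
    have hfst : ContDiffOn ℝ ∞ (Prod.fst : E × E → E) (U ×ˢ Set.univ) := contDiffOn_fst
    have hsnd : ContDiffOn ℝ ∞ (Prod.snd : E × E → E) (U ×ˢ Set.univ) := contDiffOn_snd
    have hmaps : Set.MapsTo Prod.fst (U ×ˢ (Set.univ : Set E)) U := fun p hp => hp.1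
    have hD : ContDiffOn ℝ ∞ (fderiv ℝ G) U :=
      hG.contDiffOn.fderiv_of_isOpen hG.isOpen (m := ∞) (by simp)
    have hG' := hG.contDiffOn.comp hfst hmaps
    exact (((((hD.comp hfst hmaps).clm_apply hsnd).clm_apply contDiffOn_const).clm_apply
      contDiffOn_const).add ((hG'.clm_apply contDiffOn_const).clm_apply contDiffOn_const)).add
      ((hG'.clm_apply contDiffOn_const).clm_apply contDiffOn_const)
  symm p hp A B := by
    rw [tangentForm_apply, tangentForm_apply, hG.fderiv_symm hp.1, hG.symm _ hp.1 A.1,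
      hG.symm _ hp.1 A.2]
    ring
  nondegenerate p hp A hA := by
    have h1 : A.1 = 0 := hG.nondegenerate _ hp.1 _ fun w => by
      simpa [tangentForm_apply] using hA (0, w)
    have h2 : A.2 = 0 := hG.nondegenerate _ hp.1 _ fun w => by
      simpa [tangentForm_apply, h1] using hA (w, 0)
    exact Prod.ext h1 h2

theorem fderiv_tangentForm (hG : IsMetricOn G U) {p : E × E} (hp : p.1 ∈ U) (A B C : E × E) :
    fderiv ℝ (Norden.tangentForm G) p A B C =
      fderiv ℝ (fderiv ℝ G) p.1 p.2 A.1 B.1 C.1 + fderiv ℝ G p.1 A.2 B.1 C.1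
        + fderiv ℝ G p.1 A.1 B.1 C.2 + fderiv ℝ G p.1 A.1 B.2 C.1 := by
  rw [← fderiv_apply₂ (hG.tangentForm.differentiableAt ⟨hp, trivial⟩)]
  simp only [tangentForm_apply]
  have hGd : HasFDerivAt (fun q : E × E => G q.1) _ p :=
    (hG.differentiableAt hp).hasFDerivAt.comp p hasFDerivAt_fst
  have h1 (b c : E) := ((hGd.clm_apply (hasFDerivAt_const b p)).clm_apply (hasFDerivAt_const c p))
  have h2 (b c : E) := (((hasFDerivAt_fderiv_apply (hG.contDiffAt hp)).clm_apply
    (hasFDerivAt_const b p)).clm_apply (hasFDerivAt_const c p))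
  rw [(((h2 B.1 C.1).fun_add (h1 B.1 C.2)).fun_add (h1 B.2 C.1)).fderiv]
  simp [fderiv_fderiv_comm (hG.contDiffAt hp) A.1 p.2]
  ring

theorem christoffelFirst_tangentForm (hG : IsMetricOn G U) {p : E × E} (hp : p.1 ∈ U)
    (A B C : E × E) :
    christoffelFirst (Norden.tangentForm G) p A B C =
      (fderiv ℝ G p.1 p.2 (christoffel G p.1 A.1 B.1) C.1
        + G p.1 (fderiv ℝ (christoffel G) p.1 p.2 A.1 B.1) C.1)
      + christoffelFirst G p.1 A.2 B.1 C.1 + christoffelFirst G p.1 A.1 B.2 C.1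
      + christoffelFirst G p.1 A.1 B.1 C.2 := by
  have key : fderiv ℝ (fun z => G z (christoffel G z A.1 B.1) C.1) p.1 p.2 =
      (1 / 2) * (fderiv ℝ (fderiv ℝ G) p.1 p.2 A.1 B.1 C.1
        + fderiv ℝ (fderiv ℝ G) p.1 p.2 B.1 A.1 C.1
        - fderiv ℝ (fderiv ℝ G) p.1 p.2 C.1 A.1 B.1) := by
    have hev : (fun z => G z (christoffel G z A.1 B.1) C.1) =ᶠ[nhds p.1] fun z =>
        (1 / 2) * (fderiv ℝ G z A.1 B.1 C.1 + fderiv ℝ G z B.1 A.1 C.1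
          - fderiv ℝ G z C.1 A.1 B.1) := by
      filter_upwards [hG.isOpen.mem_nhds hp] with z hz
      rw [hG.apply_christoffel hz, christoffelFirst_apply]
    rw [hev.fderiv_eq]
    have hD : DifferentiableAt ℝ (fderiv ℝ G) p.1 :=
      ((hG.contDiffAt hp).fderiv_right (m := ∞) (by simp)).differentiableAt (by simp)
    have h (a b c : E) := ((hD.hasFDerivAt.clm_apply (hasFDerivAt_const a p.1)).clm_apply
      (hasFDerivAt_const b p.1)).clm_apply (hasFDerivAt_const c p.1)
    rw [((((h A.1 B.1 C.1).fun_add (h B.1 A.1 C.1)).fun_sub (h C.1 A.1 B.1)).const_mul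
      (1 / 2)).fderiv]
    simp
  have key' : fderiv ℝ (fun z => G z (christoffel G z A.1 B.1) C.1) p.1 p.2 =
      fderiv ℝ G p.1 p.2 (christoffel G p.1 A.1 B.1) C.1
        + G p.1 (fderiv ℝ (christoffel G) p.1 p.2 A.1 B.1) C.1 := by
    have hΓ := ((hG.differentiableAt_christoffel hp).hasFDerivAt.clm_apply
      (hasFDerivAt_const A.1 p.1)).clm_apply (hasFDerivAt_const B.1 p.1)
    rw [(((hG.differentiableAt hp).hasFDerivAt.clm_apply hΓ).clm_apply
      (hasFDerivAt_const C.1 p.1)).fderiv]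
    simp
    ring
  rw [← key', key]
  simp only [christoffelFirst_apply, hG.fderiv_tangentForm hp]
  ring

/-- The Levi-Civita connection of the complete lift. -/
theorem christoffel_tangentForm (hG : IsMetricOn G U) {p : E × E} (hp : p.1 ∈ U) (A B : E × E) :
    christoffel (Norden.tangentForm G) p A B =
      (christoffel G p.1 A.1 B.1, fderiv ℝ (christoffel G) p.1 p.2 A.1 B.1
        + christoffel G p.1 A.2 B.1 + christoffel G p.1 A.1 B.2) := by
  refine hG.tangentForm.eq_christoffel ⟨hp, trivial⟩ fun C => ?_
  rw [tangentForm_apply, hG.christoffelFirst_tangentForm hp]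
  simp only [← hG.apply_christoffel hp, map_add, add_apply]
  ring

theorem fderiv_riemann (hG : IsMetricOn G U) (hy : y ∈ U) (v a b c : E) :
    fderiv ℝ (fun z => riemann G z a b c) y v =
      fderiv ℝ (fderiv ℝ (christoffel G)) y v a b c - fderiv ℝ (fderiv ℝ (christoffel G)) y v b a c
      + (fderiv ℝ (christoffel G) y v a (christoffel G y b c)
        + christoffel G y a (fderiv ℝ (christoffel G) y v b c))
      - (fderiv ℝ (christoffel G) y v b (christoffel G y a c)
        + christoffel G y b (fderiv ℝ (christoffel G) y v a c)) := by
  have hev : (fun z => riemann G z a b c) =ᶠ[nhds y] fun z =>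
      fderiv ℝ (christoffel G) z a b c - fderiv ℝ (christoffel G) z b a c
      + christoffel G z a (christoffel G z b c) - christoffel G z b (christoffel G z a c) := by
    filter_upwards [hG.isOpen.mem_nhds hy] with z hz using hG.riemann_eq hz a b c
  rw [hev.fderiv_eq]
  have hΓ := (hG.differentiableAt_christoffel hy).hasFDerivAt
  have hD : DifferentiableAt ℝ (fderiv ℝ (christoffel G)) y :=
    ((hG.contDiffAt_christoffel hy).fderiv_right (m := ∞) (by simp)).differentiableAt (by simp)
  have h0 (a : E) := hΓ.clm_apply (hasFDerivAt_const a y)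
  have h1 (a b : E) := (h0 a).clm_apply (hasFDerivAt_const b y)
  have h2 (a b c : E) := ((hD.hasFDerivAt.clm_apply (hasFDerivAt_const a y)).clm_apply
      (hasFDerivAt_const b y)).clm_apply (hasFDerivAt_const c y)
  rw [((((h2 a b c).fun_sub (h2 b a c)).fun_add ((h0 a).clm_apply (h1 b c))).fun_sub
    ((h0 b).clm_apply (h1 a c))).fderiv]
  simp
  abel

/-- The curvature of the complete lift. -/
theorem riemann_tangentForm (hG : IsMetricOn G U) {p : E × E} (hp : p.1 ∈ U) (A B C : E × E) :
    riemann (Norden.tangentForm G) p A B C =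
      (riemann G p.1 A.1 B.1 C.1, fderiv ℝ (fun z => riemann G z A.1 B.1 C.1) p.1 p.2
        + riemann G p.1 A.2 B.1 C.1 + riemann G p.1 A.1 B.2 C.1 + riemann G p.1 A.1 B.1 C.2) := by
  have hderiv (A B C : E × E) :
      fderiv ℝ (fun q => christoffel (Norden.tangentForm G) q B C) p A =
        (fderiv ℝ (christoffel G) p.1 A.1 B.1 C.1,
          fderiv ℝ (fderiv ℝ (christoffel G)) p.1 p.2 A.1 B.1 C.1
            + fderiv ℝ (christoffel G) p.1 A.2 B.1 C.1 + fderiv ℝ (christoffel G) p.1 A.1 B.2 C.1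
            + fderiv ℝ (christoffel G) p.1 A.1 B.1 C.2) := by
    have hev : (fun q => christoffel (Norden.tangentForm G) q B C) =ᶠ[nhds p] fun q =>
        (christoffel G q.1 B.1 C.1, fderiv ℝ (christoffel G) q.1 q.2 B.1 C.1
          + christoffel G q.1 B.2 C.1 + christoffel G q.1 B.1 C.2) := by
      filter_upwards [(hG.isOpen.prod isOpen_univ).mem_nhds
        (show p ∈ U ×ˢ (Set.univ : Set E) from ⟨hp, trivial⟩)] with q hq
      exact hG.christoffel_tangentForm hq.1 B C
    rw [hev.fderiv_eq]
    have hΓ : HasFDerivAt (fun q : E × E => christoffel G q.1) _ p :=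
      (hG.differentiableAt_christoffel hp).hasFDerivAt.comp p hasFDerivAt_fst
    have h1 (b c : E) := ((hΓ.clm_apply (hasFDerivAt_const b p)).clm_apply (hasFDerivAt_const c p))
    have h2 (b c : E) := (((hasFDerivAt_fderiv_apply (hG.contDiffAt_christoffel hp)).clm_apply
      (hasFDerivAt_const b p)).clm_apply (hasFDerivAt_const c p))
    rw [((h1 B.1 C.1).prodMk
      (((h2 B.1 C.1).fun_add (h1 B.2 C.1)).fun_add (h1 B.1 C.2))).fderiv]
    simp [fderiv_fderiv_comm (hG.contDiffAt_christoffel hp) A.1 p.2]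
    abel
  rw [riemann, hderiv, hderiv, hG.fderiv_riemann hp]
  simp only [hG.christoffel_tangentForm hp, hG.riemann_eq hp]
  ext
  · simp
  · simp
    abel

end IsMetricOn

/-! ### Germs -/

theorem christoffel_congr {G G' : E → E →L[ℝ] E →L[ℝ] ℝ} {y : E} (h : G =ᶠ[nhds y] G') :
    christoffel G y = christoffel G' y := by
  rw [christoffel, christoffel, christoffelFirst, christoffelFirst, h.fderiv_eq, h.eq_of_nhds]

theorem riemann_congr {G G' : E → E →L[ℝ] E →L[ℝ] ℝ} {y : E} (h : G =ᶠ[nhds y] G') (a b c : E) :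
    riemann G y a b c = riemann G' y a b c := by
  have h' (b c : E) : (fun z => christoffel G z b c) =ᶠ[nhds y] fun z => christoffel G' z b c := by
    filter_upwards [h.eventuallyEq_nhds] with z hz
    rw [christoffel_congr hz]
  rw [riemann, riemann, (h' b c).fderiv_eq, (h' a c).fderiv_eq, christoffel_congr h]

/-! ### Algebraic properties of the curvature -/

theorem riemann_swap (G : E → E →L[ℝ] E →L[ℝ] ℝ) (y a b c : E) :
    riemann G y a b c = -riemann G y b a c := by
  rw [riemann, riemann]
  abel

theorem riemann_self (G : E → E →L[ℝ] E →L[ℝ] ℝ) (y a c : E) : riemann G y a a c = 0 := by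
  rw [riemann]
  abel

theorem nablaRiemann_self (G : E → E →L[ℝ] E →L[ℝ] ℝ) (y u a c : E) :
    nablaRiemann G y u a a c = 0 := by
  simp [nablaRiemann, riemann_self, riemann_swap G y a (christoffel G y u a)]

end Coordinates

section Pullback

variable {E : Type*} [NormedAddCommGroup E] [NormedSpace ℝ E]

/-- The tangent map of `φ`. -/
def tangentFun (φ : E → E) (q : E × E) : E × E := (φ q.1, fderiv ℝ φ q.1 q.2)

theorem fderiv_tangentFun {φ : E → E} {p : E × E} (hφ : ContDiffAt ℝ ∞ φ p.1) (A : E × E) :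
    fderiv ℝ (tangentFun φ) p A =
      (fderiv ℝ φ p.1 A.1, fderiv ℝ (fderiv ℝ φ) p.1 p.2 A.1 + fderiv ℝ φ p.1 A.2) := by
  have h1 : HasFDerivAt (fun q : E × E => φ q.1) _ p :=
    (hφ.differentiableAt (by simp)).hasFDerivAt.comp p hasFDerivAt_fst
  have h := h1.prodMk (hasFDerivAt_fderiv_apply hφ)
  have h' : HasFDerivAt (tangentFun φ) _ p := h
  rw [h'.fderiv]
  ext
  · simp
  · simp [fderiv_fderiv_comm hφ A.1 p.2, add_comm]

/-- The complete lift is natural. -/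
theorem tangentForm_pullback {G G' : E → E →L[ℝ] E →L[ℝ] ℝ} {φ : E → E} {p : E × E}
    (hφ : ContDiffAt ℝ ∞ φ p.1) (hG' : DifferentiableAt ℝ G' (φ p.1))
    (h : G =ᶠ[nhds p.1] fun y => pullForm (G' (φ y)) (fderiv ℝ φ y) (fderiv ℝ φ y))
    (hG : DifferentiableAt ℝ G p.1) :
    tangentForm G p = pullForm (tangentForm G' (tangentFun φ p)) (fderiv ℝ (tangentFun φ) p)
      (fderiv ℝ (tangentFun φ) p) := by
  have hval (a b : E) : G p.1 a b = G' (φ p.1) (fderiv ℝ φ p.1 a) (fderiv ℝ φ p.1 b) := by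
    rw [h.eq_of_nhds, pullForm_apply]
  have hder (v a b : E) : fderiv ℝ G p.1 v a b =
      fderiv ℝ G' (φ p.1) (fderiv ℝ φ p.1 v) (fderiv ℝ φ p.1 a) (fderiv ℝ φ p.1 b)
      + G' (φ p.1) (fderiv ℝ (fderiv ℝ φ) p.1 v a) (fderiv ℝ φ p.1 b)
      + G' (φ p.1) (fderiv ℝ φ p.1 a) (fderiv ℝ (fderiv ℝ φ) p.1 v b) := by
    have hev : (fun y => G y a b) =ᶠ[nhds p.1]
        fun y => G' (φ y) (fderiv ℝ φ y a) (fderiv ℝ φ y b) := by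
      filter_upwards [h] with y hy
      rw [hy, pullForm_apply]
    rw [← fderiv_apply₂ hG, hev.fderiv_eq]
    have h1 : HasFDerivAt (fun y => G' (φ y)) _ p.1 :=
      hG'.hasFDerivAt.comp p.1 (hφ.differentiableAt (by simp)).hasFDerivAt
    have hD : DifferentiableAt ℝ (fderiv ℝ φ) p.1 :=
      (hφ.fderiv_right (m := ∞) (by simp)).differentiableAt (by simp)
    have h2 (c : E) := hD.hasFDerivAt.clm_apply (hasFDerivAt_const c p.1)
    rw [((h1.clm_apply (h2 a)).clm_apply (h2 b)).fderiv]
    simp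
    ring
  refine ContinuousLinearMap.ext fun A => ContinuousLinearMap.ext fun B => ?_
  rw [pullForm_apply, fderiv_tangentFun hφ, fderiv_tangentFun hφ, tangentForm_apply,
    tangentForm_apply, hder, hval, hval]
  simp only [tangentFun, map_add, add_apply]
  ring

end Pullback

section Charts

variable {E : Type*} [NormedAddCommGroup E] [NormedSpace ℝ E]
  {H : Type*} [TopologicalSpace H] {I : ModelWithCorners ℝ E H}
  {M : Type*} [TopologicalSpace M] [ChartedSpace H M]

theorem inChart_apply_of_mem [IsManifold I 1 M] (g : FormField I M) {x p : M}
    (hp : p ∈ (extChartAt I x).source) (v w : E) :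
    inChart g x (extChartAt I x p) v w =
      g p (tangentCoordChange I x p p v) (tangentCoordChange I x p p w) := by
  rw [inChart, pullForm_apply, (extChartAt I x).left_inv hp,
    TangentBundle.symmL_trivializationAt_eq_core (by rwa [extChartAt_source] at hp)]
  rfl

theorem inChart_self [IsManifold I 1 M] (g : FormField I M) (x : M) (v w : E) :
    inChart g x (extChartAt I x x) v w = g x v w := by
  have hx := mem_extChartAt_source (I := I) x
  rw [inChart_apply_of_mem g hx, tangentCoordChange_self hx, tangentCoordChange_self hx]

variable [I.Boundaryless]

theorem fderiv_coordChange [IsManifold I 1 M] {x x' p : M} :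
    fderiv ℝ (extChartAt I x' ∘ (extChartAt I x).symm) (extChartAt I x p) =
      tangentCoordChange I x x' p := by
  rw [tangentCoordChange_def, I.range_eq_univ, fderivWithin_univ]

theorem isOpen_coordChange_source (x x' : M) :
    IsOpen ((extChartAt I x).symm ≫ extChartAt I x').source := by
  rw [PartialEquiv.trans_source, PartialEquiv.symm_source]
  exact (continuousOn_extChartAt_symm x).isOpen_inter_preimage
    (isOpen_extChartAt_target x) (isOpen_extChartAt_source x')

theorem contDiffAt_coordChange [IsManifold I ∞ M] {x x' p : M}
    (hp : p ∈ (extChartAt I x).source) (hp' : p ∈ (extChartAt I x').source) :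
    ContDiffAt ℝ ∞ (extChartAt I x' ∘ (extChartAt I x).symm) (extChartAt I x p) := by
  have h' : extChartAt I x p ∈ ((extChartAt I x).symm ≫ (extChartAt I x')).source := by
    rw [PartialEquiv.trans_source'', PartialEquiv.symm_symm, PartialEquiv.symm_target]
    exact Set.mem_image_of_mem _ ⟨hp, hp'⟩
  have := contDiffWithinAt_ext_coord_change (n := ∞) x' x h'
  rwa [I.range_eq_univ, contDiffWithinAt_univ] at this

variable [IsManifold I ∞ M]

theorem inChart_eq_pullForm (g : FormField I M) {x x' p : M}
    (hp : p ∈ (extChartAt I x).source) (hp' : p ∈ (extChartAt I x').source) :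
    inChart g x (extChartAt I x p) = pullForm (inChart g x' (extChartAt I x' p))
      (fderiv ℝ (extChartAt I x' ∘ (extChartAt I x).symm) (extChartAt I x p))
      (fderiv ℝ (extChartAt I x' ∘ (extChartAt I x).symm) (extChartAt I x p)) := by
  ext1 v
  ext1 w
  have hpp := mem_extChartAt_source (I := I) p
  rw [inChart_apply_of_mem g hp, pullForm_apply, fderiv_coordChange, inChart_apply_of_mem g hp',
    tangentCoordChange_comp ⟨⟨hp, hp'⟩, hpp⟩, tangentCoordChange_comp ⟨⟨hp, hp'⟩, hpp⟩]

theorem IsPseudoRiemannianMetric.isMetricOn [FiniteDimensional ℝ E] {g : FormField I M}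
    (hg : IsPseudoRiemannianMetric I M g) (x : M) :
    IsMetricOn (inChart g x) (extChartAt I x).target where
  isOpen := isOpen_extChartAt_target x
  contDiffOn := by
    rw [contDiffOn_clm_apply]
    intro v
    rw [contDiffOn_clm_apply]
    intro w
    set e := trivializationAt E (TangentSpace I : M → Type _) x
    have hsec (v : E) : ContMDiffOn I (I.prod 𝓘(ℝ, E)) ∞
        (fun p : M => TotalSpace.mk' E (E := (TangentSpace I : M → Type _)) p (e.symmL ℝ p v))
        e.baseSet := by
      have h1 : ContMDiffOn I (I.prod 𝓘(ℝ, E)) ∞ (fun p : M => (p, v)) e.baseSet :=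
        (contMDiff_id.prodMk contMDiff_const).contMDiffOn
      refine ((e.contMDiffOn_symm (n := ∞)).comp h1 fun p hp => ?_).congr fun p hp => ?_
      · rw [e.target_eq]
        exact ⟨hp, trivial⟩
      · rw [e.symmL_apply hp]
        exact e.mk_symm hp v
    have hval : ContMDiffOn I 𝓘(ℝ, ℝ) ∞ (fun p : M => g p (e.symmL ℝ p v) (e.symmL ℝ p w))
        e.baseSet := by
      have : ContMDiffOn I (I.prod 𝓘(ℝ, ℝ)) ∞ (fun p : M => TotalSpace.mk' ℝ
          (E := Bundle.Trivial M ℝ) p (g p (e.symmL ℝ p v) (e.symmL ℝ p w))) e.baseSet :=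
        ContMDiffOn.clm_bundle_apply₂ (F₁ := E) (F₂ := E) (b := fun p => p)
          hg.contMDiff.contMDiffOn (hsec v) (hsec w)
      intro p hp
      exact (contMDiffWithinAt_totalSpace.1 (this p hp)).2
    rw [← contMDiffOn_iff_contDiffOn]
    refine hval.comp (contMDiffOn_extChartAt_symm x) fun y hy => ?_
    have := (extChartAt I x).map_target hy
    rwa [extChartAt_source] at this
  symm y _ v w := hg.symm _ _ _
  nondegenerate y hy v hv := by
    set e := trivializationAt E (TangentSpace I : M → Type _) x
    have hp : (extChartAt I x).symm y ∈ e.baseSet := by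
      have := (extChartAt I x).map_target hy
      rwa [extChartAt_source] at this
    have h0 : e.symmL ℝ ((extChartAt I x).symm y) v = 0 := by
      refine hg.nondegenerate _ _ fun w => ?_
      rw [← e.symmL_continuousLinearMapAt (R := ℝ) hp w]
      exact hv _
    rw [← e.continuousLinearMapAt_symmL (R := ℝ) hp v, h0, map_zero]

end Charts

section TangentBundle

variable {E : Type*} [NormedAddCommGroup E] [NormedSpace ℝ E]
  {H : Type*} [TopologicalSpace H] {I : ModelWithCorners ℝ E H}
  {M : Type*} [TopologicalSpace M] [ChartedSpace H M]

theorem extChartAt_tangentBundle [IsManifold I 1 M] (u w : TangentBundle I M) :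
    extChartAt I.tangent u w =
      (extChartAt I u.proj w.proj, tangentCoordChange I w.proj u.proj w.proj w.snd) := rfl

theorem extChartAt_tangentBundle_self [IsManifold I 1 M] (u : TangentBundle I M) :
    extChartAt I.tangent u u = (extChartAt I u.proj u.proj, u.snd) := by
  rw [extChartAt_tangentBundle]
  have h (v : E) : tangentCoordChange I u.proj u.proj u.proj v = v :=
    tangentCoordChange_self (mem_extChartAt_source u.proj)
  exact Prod.ext rfl (h u.snd)

theorem extChartAt_tangentBundle_symm [IsManifold I 1 M] (u : TangentBundle I M) {q : E × E} :
    (extChartAt I.tangent u).symm q = ⟨(extChartAt I u.proj).symm q.1,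
      tangentCoordChange I u.proj ((extChartAt I u.proj).symm q.1)
        ((extChartAt I u.proj).symm q.1) q.2⟩ := by
  rfl

theorem extChartAt_tangentBundle_target [IsManifold I 1 M] (u : TangentBundle I M) :
    (extChartAt I.tangent u).target = (extChartAt I u.proj).target ×ˢ Set.univ := by
  have h := FiberBundle.extChartAt_target (IB := I) (E := (TangentSpace I : M → Type _)) u
  refine h.trans ?_
  congr 1
  refine Set.inter_eq_left.2 fun y hy => ?_
  have := (extChartAt I u.proj).map_target hy
  rwa [extChartAt_source] at this

variable [I.Boundaryless] [IsManifold I ∞ M]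

theorem coordChange_tangentBundle_eventuallyEq (u w : TangentBundle I M) {q : E × E}
    (hq : q.1 ∈ (extChartAt I u.proj).target)
    (hq' : (extChartAt I u.proj).symm q.1 ∈ (extChartAt I w.proj).source) :
    extChartAt I.tangent w ∘ (extChartAt I.tangent u).symm =ᶠ[nhds q]
      tangentFun (extChartAt I w.proj ∘ (extChartAt I u.proj).symm) := by
  have hmem : {r : E × E | r.1 ∈ ((extChartAt I u.proj).symm ≫ extChartAt I w.proj).source} ∈
      nhds q := ((isOpen_coordChange_source _ _).preimage continuous_fst).mem_nhds ⟨hq, hq'⟩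
  filter_upwards [hmem] with r hr
  set p := (extChartAt I u.proj).symm r.1 with hp
  have hr1 : r.1 = extChartAt I u.proj p := ((extChartAt I u.proj).right_inv hr.1).symm
  have hps : p ∈ (extChartAt I u.proj).source := (extChartAt I u.proj).map_target hr.1
  rw [Function.comp_apply, extChartAt_tangentBundle_symm, extChartAt_tangentBundle, ← hp]
  refine Prod.ext rfl ?_
  change tangentCoordChange I p w.proj p (tangentCoordChange I u.proj p p r.2) =
    fderiv ℝ (extChartAt I w.proj ∘ (extChartAt I u.proj).symm) r.1 r.2
  rw [hr1, fderiv_coordChange,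
    tangentCoordChange_comp ⟨⟨hps, mem_extChartAt_source p⟩, hr.2⟩]

variable [FiniteDimensional ℝ E] {g : FormField I M}

theorem IsPseudoRiemannianMetric.completeLift_eq_tangentForm (hg : IsPseudoRiemannianMetric I M g)
    (u : TangentBundle I M) (A B : E × E) :
    completeLift g u A B =
      tangentForm (inChart g u.proj) (extChartAt I u.proj u.proj, u.snd) A B := by
  have hG := hg.isMetricOn u.proj
  have hy := mem_extChartAt_target (I := I) u.proj
  set y := extChartAt I u.proj u.proj
  let v : E := u.snd
  have h : completeLift g u A B =
      inChart g u.proj y A.1 (B.2 + christoffel (inChart g u.proj) y v B.1)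
      + inChart g u.proj y (A.2 + christoffel (inChart g u.proj) y v A.1) B.1 := by
    rw [inChart_self, inChart_self]
    rfl
  refine h.trans (Eq.trans ?_ (tangentForm_apply (inChart g u.proj) (y, v) A B).symm)
  rw [hG.fderiv_eq_christoffel hy, map_add, map_add, add_apply]
  ring

/-- The complete lift is given in the charts of `TM` by the complete lift in coordinates. -/
theorem IsPseudoRiemannianMetric.inChart_completeLift (hg : IsPseudoRiemannianMetric I M g)
    (u : TangentBundle I M) {q : E × E} (hq : q.1 ∈ (extChartAt I u.proj).target) :
    inChart (completeLift g) u q = tangentForm (inChart g u.proj) q := by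
  set w := (extChartAt I.tangent u).symm q with hw
  have hps : w.proj ∈ (extChartAt I u.proj).source := (extChartAt I u.proj).map_target hq
  have hpw := mem_extChartAt_source (I := I) w.proj
  have hq1 : q.1 = extChartAt I u.proj w.proj := ((extChartAt I u.proj).right_inv hq).symm
  have hqt : q ∈ (extChartAt I.tangent u).target := by
    rw [extChartAt_tangentBundle_target]
    exact ⟨hq, trivial⟩
  have hws : w ∈ (extChartAt I.tangent u).source := (extChartAt I.tangent u).map_target hqt
  have hqw : extChartAt I.tangent u w = q := (extChartAt I.tangent u).right_inv hqt
  set φ := extChartAt I w.proj ∘ (extChartAt I u.proj).symm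
  have hT : tangentFun φ q = (extChartAt I w.proj w.proj, w.snd) := by
    rw [← (coordChange_tangentBundle_eventuallyEq u w hq hpw).eq_of_nhds, Function.comp_apply,
      ← hw, extChartAt_tangentBundle_self]
  have hcoord : tangentCoordChange I.tangent u w w = fderiv ℝ (tangentFun φ) q := by
    rw [← fderiv_coordChange, hqw,
      (coordChange_tangentBundle_eventuallyEq u w hq hpw).fderiv_eq]
  have hpull : tangentForm (inChart g u.proj) q = pullForm
      (tangentForm (inChart g w.proj) (tangentFun φ q)) (fderiv ℝ (tangentFun φ) q)
      (fderiv ℝ (tangentFun φ) q) := by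
    have hφq : φ q.1 = extChartAt I w.proj w.proj := rfl
    refine tangentForm_pullback ?_ ?_ ?_ ((hg.isMetricOn u.proj).differentiableAt hq)
    · rw [hq1]
      exact contDiffAt_coordChange hps hpw
    · rw [hφq]
      exact (hg.isMetricOn w.proj).differentiableAt (mem_extChartAt_target w.proj)
    · filter_upwards [(isOpen_coordChange_source u.proj w.proj).mem_nhds ⟨hq, hpw⟩] with y hy
      have hy' := (extChartAt I u.proj).right_inv hy.1
      have := inChart_eq_pullForm g ((extChartAt I u.proj).map_target hy.1) hy.2
      rwa [hy'] at this
  refine ContinuousLinearMap.ext fun A => ContinuousLinearMap.ext fun B => ?_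
  rw [hpull, pullForm_apply, hT, ← hcoord, ← hqw]
  exact (inChart_apply_of_mem (completeLift g) hws A B).trans
    (hg.completeLift_eq_tangentForm w _ _)

theorem IsPseudoRiemannianMetric.curvature_completeLift (hg : IsPseudoRiemannianMetric I M g)
    (u : TangentBundle I M) (A B C : TangentSpace I.tangent u) :
    curvature (completeLift g) u A B C = riemann (E := E × E) (tangentForm (inChart g u.proj))
      (extChartAt I u.proj u.proj, u.snd) A B C := by
  rw [curvature, extChartAt_tangentBundle_self]
  refine riemann_congr (E := E × E) ?_ A B C
  filter_upwards [((isOpen_extChartAt_target (I := I) u.proj).prod isOpen_univ).mem_nhds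
    (show (extChartAt I u.proj u.proj, u.snd) ∈ _ ×ˢ Set.univ from
      ⟨mem_extChartAt_target u.proj, trivial⟩)] with q hq
  exact hg.inChart_completeLift u hq.1

end TangentBundle

namespace IsMetricOn

variable {E : Type*} [NormedAddCommGroup E] [NormedSpace ℝ E] [FiniteDimensional ℝ E]
  {G : E → E →L[ℝ] E →L[ℝ] ℝ} {U : Set E} {y : E}

theorem riemann_add₁ (hG : IsMetricOn G U) (hy : y ∈ U) (a a' b c : E) :
    riemann G y (a + a') b c = riemann G y a b c + riemann G y a' b c := by
  simp only [hG.riemann_eq hy, map_add, add_apply]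
  abel

theorem riemann_add₂ (hG : IsMetricOn G U) (hy : y ∈ U) (a b b' c : E) :
    riemann G y a (b + b') c = riemann G y a b c + riemann G y a b' c := by
  simp only [hG.riemann_eq hy, map_add, add_apply]
  abel

theorem riemann_add₃ (hG : IsMetricOn G U) (hy : y ∈ U) (a b c c' : E) :
    riemann G y a b (c + c') = riemann G y a b c + riemann G y a b c' := by
  simp only [hG.riemann_eq hy, map_add]
  abel

theorem riemann_smul (hG : IsMetricOn G U) (hy : y ∈ U) (r s t : ℝ) (a b c : E) :
    riemann G y (r • a) (s • b) (t • c) = (r * s * t) • riemann G y a b c := by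
  simp only [hG.riemann_eq hy, map_smul, smul_apply]
  module

end IsMetricOn

section TangentBundle

variable {E : Type*} [NormedAddCommGroup E] [NormedSpace ℝ E] [FiniteDimensional ℝ E]
  {H : Type*} [TopologicalSpace H] {I : ModelWithCorners ℝ E H} [I.Boundaryless]
  {M : Type*} [TopologicalSpace M] [ChartedSpace H M] [IsManifold I ∞ M] {g : FormField I M}

namespace IsPseudoRiemannianMetric

theorem curvature_smul (hg : IsPseudoRiemannianMetric I M g) (x : M) (r s t : ℝ)
    (a b c : TangentSpace I x) :
    curvature g x (r • a) (s • b) (t • c) = (r * s * t) • curvature g x a b c :=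
  (hg.isMetricOn x).riemann_smul (mem_extChartAt_target x) r s t a b c

theorem curvature_completeLift_smul (hg : IsPseudoRiemannianMetric I M g) (u : TangentBundle I M)
    (r s t : ℝ) (A B C : TangentSpace I.tangent u) :
    curvature (completeLift g) u (r • A) (s • B) (t • C) =
      (r * s * t) • curvature (completeLift g) u A B C := by
  rw [hg.curvature_completeLift, hg.curvature_completeLift]
  exact (hg.isMetricOn u.proj).tangentForm.riemann_smul ⟨mem_extChartAt_target u.proj, trivial⟩
    r s t A B C

/-- The horizontal part of the curvature of the complete lift. -/
theorem dproj_curvature_completeLift (hg : IsPseudoRiemannianMetric I M g)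
    (u : TangentBundle I M) (A B C : TangentSpace I.tangent u) :
    dproj u (curvature (completeLift g) u A B C) =
      curvature g u.proj (dproj u A) (dproj u B) (dproj u C) := by
  rw [hg.curvature_completeLift]
  exact congrArg Prod.fst ((hg.isMetricOn u.proj).riemann_tangentForm
    (p := (extChartAt I u.proj u.proj, u.snd)) (mem_extChartAt_target u.proj) A B C)

/-- The vertical part of the curvature of the complete lift. -/
theorem connector_curvature_completeLift (hg : IsPseudoRiemannianMetric I M g)
    (u : TangentBundle I M) (A B C : TangentSpace I.tangent u) :
    connector g u (curvature (completeLift g) u A B C) =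
      nablaCurvature g u.proj u.snd (dproj u A) (dproj u B) (dproj u C)
      + curvature g u.proj (connector g u A) (dproj u B) (dproj u C)
      + curvature g u.proj (dproj u A) (connector g u B) (dproj u C)
      + curvature g u.proj (dproj u A) (dproj u B) (connector g u C) := by
  rw [hg.curvature_completeLift]
  have hG := hg.isMetricOn u.proj
  have hy := mem_extChartAt_target (I := I) u.proj
  set G := inChart g u.proj
  set y := extChartAt I u.proj u.proj
  have key (v : E) (A B C : E × E) : (riemann (tangentForm G) (y, v) A B C).2
      + christoffel G y v (riemann (tangentForm G) (y, v) A B C).1 =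
      nablaRiemann G y v A.1 B.1 C.1 + riemann G y (A.2 + christoffel G y v A.1) B.1 C.1
        + riemann G y A.1 (B.2 + christoffel G y v B.1) C.1
        + riemann G y A.1 B.1 (C.2 + christoffel G y v C.1) := by
    rw [hG.riemann_tangentForm (p := (y, v)) hy, hG.riemann_add₁ hy, hG.riemann_add₂ hy,
      hG.riemann_add₃ hy, nablaRiemann]
    dsimp only
    abel
  exact key u.snd A B C

end IsPseudoRiemannianMetric

/-- The vector `(X^H + ε X^V) / √2`. -/
def tilt (g : FormField I M) (u : TangentBundle I M) (ε : ℝ) (X : TangentSpace I u.proj) :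
    TangentSpace I.tangent u :=
  (1 / √2 : ℝ) • (hLift g u X + ε • vLift u X)

omit [FiniteDimensional ℝ E] [I.Boundaryless] in
theorem xi_eq_tilt (g : FormField I M) (u : TangentBundle I M) (X : TangentSpace I u.proj) :
    xi g u X = tilt g u 1 X := by
  rw [xi, tilt, one_smul]

omit [FiniteDimensional ℝ E] [I.Boundaryless] in
theorem eta_eq_tilt (g : FormField I M) (u : TangentBundle I M) (X : TangentSpace I u.proj) :
    eta g u X = tilt g u (-1) X := by
  rw [eta, tilt, neg_smul, one_smul, sub_eq_add_neg]

theorem inv_sqrt_two_mul_self : (1 / √2 : ℝ) * (1 / √2) = 1 / 2 := by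
  rw [div_mul_div_comm, one_mul, Real.mul_self_sqrt (by norm_num)]

omit [FiniteDimensional ℝ E] [I.Boundaryless] in
theorem completeLift_tilt (g : FormField I M) (u : TangentBundle I M) (ε δ : ℝ)
    (X Y : TangentSpace I u.proj) :
    completeLift g u (tilt g u ε X) (tilt g u δ Y) = (ε + δ) / 2 * g u.proj X Y := by
  simp only [tilt, map_smul, map_add, add_apply, smul_apply, smul_eq_mul,
    completeLift_hLift_hLift, completeLift_hLift_vLift, completeLift_vLift_hLift,
    completeLift_vLift_vLift]
  linear_combination (ε + δ) * g u.proj X Y * inv_sqrt_two_mul_self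

omit [FiniteDimensional ℝ E] [I.Boundaryless] in
theorem gram_tilt (g : FormField I M) (u : TangentBundle I M) (ε δ : ℝ)
    (X Y : TangentSpace I u.proj) :
    gram (completeLift g) u (tilt g u ε X) (tilt g u δ Y) =
      ε * δ * (g u.proj Y Y * g u.proj X X)
        - ((ε + δ) / 2) ^ 2 * (g u.proj X Y * g u.proj Y X) := by
  rw [gram]
  simp only [completeLift_tilt]
  ring

theorem IsPseudoRiemannianMetric.completeLift_curvature_tilt (hg : IsPseudoRiemannianMetric I M g)
    (u : TangentBundle I M) (ε δ : ℝ) (X Y : TangentSpace I u.proj) :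
    completeLift g u (curvature (completeLift g) u (tilt g u ε X) (tilt g u δ Y) (tilt g u δ Y))
        (tilt g u ε X) =
      1 / 4 * g u.proj (nablaCurvature g u.proj u.snd X Y Y) X
        + (ε + δ) / 2 * g u.proj (curvature g u.proj X Y Y) X := by
  have hd (ε : ℝ) (X : TangentSpace I u.proj) :
      dproj u (hLift g u X + ε • vLift u X) = X := by
    simp [dproj_hLift, dproj_vLift]
  have hk (ε : ℝ) (X : TangentSpace I u.proj) :
      connector g u (hLift g u X + ε • vLift u X) = ε • X := by
    simp [connector_hLift, connector_vLift]
  have h1 : curvature g u.proj (ε • X) Y Y = ε • curvature g u.proj X Y Y := by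
    simpa using hg.curvature_smul u.proj ε 1 1 X Y Y
  have h2 : curvature g u.proj X (δ • Y) Y = δ • curvature g u.proj X Y Y := by
    simpa using hg.curvature_smul u.proj 1 δ 1 X Y Y
  have h3 : curvature g u.proj X Y (δ • Y) = δ • curvature g u.proj X Y Y := by
    simpa using hg.curvature_smul u.proj 1 1 δ X Y Y
  simp only [tilt]
  rw [hg.curvature_completeLift_smul]
  simp only [map_smul, smul_apply, completeLift_apply, hg.dproj_curvature_completeLift,
    hg.connector_curvature_completeLift, hd, hk, h1, h2, h3]
  simp only [map_smul, smul_apply, map_add, add_apply, smul_eq_mul]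
  generalize g u.proj (nablaCurvature g u.proj u.snd X Y Y) X = N
  generalize g u.proj (curvature g u.proj X Y Y) X = K
  linear_combination (N + 2 * (ε + δ) * K) * ((1 / √2 : ℝ) * (1 / √2) + 1 / 2)
    * inv_sqrt_two_mul_self

end TangentBundle

section Holomorphic

variable {V : Type*} [AddCommGroup V] [Module ℝ V] [TopologicalSpace V]

/-- If `L` permutes independent vectors up to sign by a fixed point free involution `σ`, then it
preserves the plane of two of them if and only if `σ` exchanges them. -/
theorem isHolomorphic_span_pair_iff {ι : Type*} {f : ι → V} (hf : LinearIndependent ℝ f)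
    {L : V →L[ℝ] V} {σ : ι → ι} (hσ : Function.Involutive σ) (hfix : ∀ i, σ i ≠ i)
    (hL : ∀ i, L (f i) = f (σ i) ∨ L (f i) = -f (σ i)) (A B : ι) :
    IsHolomorphic L (Submodule.span ℝ {f A, f B}) ↔ σ A = B := by
  have hmem (β : Submodule ℝ V) (i : ι) : L (f i) ∈ β ↔ f (σ i) ∈ β := by
    rcases hL i with h | h <;> simp [h]
  constructor
  · intro h
    have hA : f (σ A) ∈ Submodule.span ℝ (f '' {A, B}) := by
      rw [Set.image_pair, ← hmem, ← h]
      exact Submodule.mem_map_of_mem (Submodule.subset_span (by simp))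
    have : σ A ∈ ({A, B} : Set ι) := by
      by_contra hn
      exact hf.notMem_span_image hn hA
    exact (by simpa using this : σ A = A ∨ σ A = B).resolve_left (hfix A)
  · rintro rfl
    have hA : f A ∈ Submodule.span ℝ {f A, f (σ A)} := Submodule.subset_span (by simp)
    have hB : f (σ A) ∈ Submodule.span ℝ {f A, f (σ A)} := Submodule.subset_span (by simp)
    apply le_antisymm
    · rw [Submodule.map_span, Submodule.span_le, Set.image_pair, Set.pair_subset_iff]
      refine ⟨(hmem _ A).2 hB, (hmem _ (σ A)).2 ?_⟩
      rwa [hσ A]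
    · rw [Submodule.span_le, Set.pair_subset_iff]
      refine ⟨?_, (hmem _ A).1 (Submodule.mem_map_of_mem hA)⟩
      have := (hmem _ (σ A)).1 (Submodule.mem_map_of_mem (f := (L : V →ₗ[ℝ] V)) hB)
      rwa [hσ A] at this

end Holomorphic

section Adapted

variable {E : Type*} [NormedAddCommGroup E] [NormedSpace ℝ E]
  {H : Type*} [TopologicalSpace H] {I : ModelWithCorners ℝ E H}
  {M : Type*} [TopologicalSpace M] [ChartedSpace H M] [IsManifold I ∞ M]
  {J : EndField I M} {g : FormField I M} {u : TangentBundle I M} {n : ℕ}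
  {e : Module.Basis (Fin n ⊕ Fin n) ℝ (TangentSpace I u.proj)}

omit [IsManifold I ∞ M] in
theorem IsOrthonormalJBasis.self_ne_zero (he : IsOrthonormalJBasis J g u.proj e)
    (a : Fin n ⊕ Fin n) : g u.proj (e a) (e a) ≠ 0 := by
  rcases he.normalized a with h | h <;> rw [h] <;> norm_num

theorem IsOrthonormalJBasis.completeLift_adapted_of_ne (he : IsOrthonormalJBasis J g u.proj e)
    {A B : (Fin n ⊕ Fin n) ⊕ (Fin n ⊕ Fin n)} (h : A ≠ B) :
    completeLift g u (adapted g u e A) (adapted g u e B) = 0 := by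
  rcases A with a | a <;> rcases B with b | b <;>
    simp only [adapted, Sum.elim_inl, Sum.elim_inr, xi_eq_tilt, eta_eq_tilt, completeLift_tilt]
  · rw [he.orthogonal a b (by simpa using h), mul_zero]
  · norm_num
  · norm_num
  · rw [he.orthogonal a b (by simpa using h), mul_zero]

theorem IsOrthonormalJBasis.completeLift_adapted_self (he : IsOrthonormalJBasis J g u.proj e)
    (A : (Fin n ⊕ Fin n) ⊕ (Fin n ⊕ Fin n)) :
    completeLift g u (adapted g u e A) (adapted g u e A) ≠ 0 := by
  rcases A with a | a <;>
    simp only [adapted, Sum.elim_inl, Sum.elim_inr, xi_eq_tilt, eta_eq_tilt, completeLift_tilt] <;>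
    exact mul_ne_zero (by norm_num) (he.self_ne_zero a)

theorem IsOrthonormalJBasis.linearIndependent_adapted (he : IsOrthonormalJBasis J g u.proj e) :
    LinearIndependent ℝ (adapted g u e) :=
  LinearMap.linearIndependent_of_isOrthoᵢ (B := (completeLift g u).toLinearMap₁₂)
    (fun _ _ h => he.completeLift_adapted_of_ne h) he.completeLift_adapted_self

theorem IsOrthonormalJBasis.gram_adapted_ne_zero (he : IsOrthonormalJBasis J g u.proj e)
    {A B : (Fin n ⊕ Fin n) ⊕ (Fin n ⊕ Fin n)} (h : A ≠ B) :
    gram (completeLift g) u (adapted g u e A) (adapted g u e B) ≠ 0 := by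
  rw [gram, he.completeLift_adapted_of_ne h, zero_mul, sub_zero]
  exact mul_ne_zero (he.completeLift_adapted_self B) (he.completeLift_adapted_self A)

theorem IsOrthonormalJBasis.J_apply (hJ : IsAlmostComplexStructure I M J)
    (he : IsOrthonormalJBasis J g u.proj e) (a : Fin n ⊕ Fin n) :
    J u.proj (e a) = e a.swap ∨ J u.proj (e a) = -e a.swap := by
  rcases a with i | i
  · exact Or.inl (he.bar i).symm
  · right
    rw [he.bar i, hJ.sq, Sum.swap_inr]

theorem J₁_tilt (J : EndField I M) (g : FormField I M) (u : TangentBundle I M) (ε : ℝ)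
    (X : TangentSpace I u.proj) :
    J₁ J g u (tilt g u ε X) = -tilt g u (-ε) (J u.proj X) := by
  rw [tilt, tilt, map_smul, map_add, map_smul, (J₁_lifts J g u X).1, (J₁_lifts J g u X).2]
  module

theorem J₂_tilt (g : FormField I M) (u : TangentBundle I M) {ε : ℝ} (hε : ε * ε = 1)
    (X : TangentSpace I u.proj) :
    J₂ g u (tilt g u ε X) = -(ε • tilt g u (-ε) X) := by
  have h : vLift u X = (ε * ε) • vLift u X := by rw [hε, one_smul]
  rw [tilt, tilt, map_smul, map_add, map_smul, (J₂_lifts g u X).1, (J₂_lifts g u X).2]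
  nth_rewrite 1 [h]
  module

theorem tilt_neg (g : FormField I M) (u : TangentBundle I M) (ε : ℝ) (X : TangentSpace I u.proj) :
    tilt g u ε (-X) = -tilt g u ε X := by
  simp only [tilt, map_neg]
  module

/-- The involution of the indices of the adapted basis induced by `J₁`. -/
def barSwap (A : (Fin n ⊕ Fin n) ⊕ (Fin n ⊕ Fin n)) : (Fin n ⊕ Fin n) ⊕ (Fin n ⊕ Fin n) :=
  (A.map Sum.swap Sum.swap).swap

theorem IsOrthonormalJBasis.J₁_adapted (hJ : IsAlmostComplexStructure I M J)
    (he : IsOrthonormalJBasis J g u.proj e) (A : (Fin n ⊕ Fin n) ⊕ (Fin n ⊕ Fin n)) :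
    J₁ J g u (adapted g u e A) = adapted g u e (barSwap A) ∨
      J₁ J g u (adapted g u e A) = -adapted g u e (barSwap A) := by
  rcases A with a | a <;>
    simp only [adapted, barSwap, Sum.map_inl, Sum.map_inr, Sum.swap_inl, Sum.swap_inr,
      Sum.elim_inl, Sum.elim_inr, xi_eq_tilt, eta_eq_tilt, J₁_tilt, neg_neg] <;>
    rcases he.J_apply hJ a with h | h <;> simp [h, tilt_neg]

theorem J₂_adapted (g : FormField I M) (u : TangentBundle I M)
    (e : Module.Basis (Fin n ⊕ Fin n) ℝ (TangentSpace I u.proj))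
    (A : (Fin n ⊕ Fin n) ⊕ (Fin n ⊕ Fin n)) :
    J₂ g u (adapted g u e A) = adapted g u e A.swap ∨
      J₂ g u (adapted g u e A) = -adapted g u e A.swap := by
  rcases A with a | a
  · right
    simp only [adapted, Sum.swap_inl, Sum.elim_inl, Sum.elim_inr, xi_eq_tilt, eta_eq_tilt]
    rw [J₂_tilt g u (by norm_num), one_smul]
  · left
    simp only [adapted, Sum.swap_inr, Sum.elim_inl, Sum.elim_inr, xi_eq_tilt, eta_eq_tilt]
    rw [J₂_tilt g u (by norm_num), neg_neg, neg_smul, one_smul, neg_neg]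

theorem IsOrthonormalJBasis.isHolomorphic_J₁_basicPlane_iff (hJ : IsAlmostComplexStructure I M J)
    (he : IsOrthonormalJBasis J g u.proj e) (A B : (Fin n ⊕ Fin n) ⊕ (Fin n ⊕ Fin n)) :
    IsHolomorphic (J₁ J g u) (basicPlane g u e A B) ↔
      ∃ i, s(A, B) = s(Sum.inl (Sum.inr i), Sum.inr (Sum.inl i)) ∨
        s(A, B) = s(Sum.inr (Sum.inr i), Sum.inl (Sum.inl i)) := by
  rw [basicPlane, isHolomorphic_span_pair_iff he.linearIndependent_adapted (σ := barSwap)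
    (fun A => by rcases A with (i | i) | (i | i) <;> rfl)
    (fun A => by rcases A with (i | i) | (i | i) <;> simp [barSwap]) (he.J₁_adapted hJ)]
  rcases A with (i | i) | (i | i) <;> rcases B with (j | j) | (j | j) <;>
    simp [barSwap, eq_comm]

theorem IsOrthonormalJBasis.isHolomorphic_J₂_basicPlane_iff
    (he : IsOrthonormalJBasis J g u.proj e) (A B : (Fin n ⊕ Fin n) ⊕ (Fin n ⊕ Fin n)) :
    IsHolomorphic (J₂ g u) (basicPlane g u e A B) ↔ ∃ a, s(A, B) = s(Sum.inr a, Sum.inl a) := by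
  rw [basicPlane, isHolomorphic_span_pair_iff he.linearIndependent_adapted (σ := Sum.swap)
    Sum.swap_swap (fun A => by rcases A with a | a <;> simp) (J₂_adapted g u e)]
  rcases A with a | a <;> rcases B with b | b <;> simp [eq_comm]

variable [FiniteDimensional ℝ E] [I.Boundaryless]

theorem IsPseudoRiemannianMetric.sectional_tilt (hg : IsPseudoRiemannianMetric I M g) (ε δ : ℝ)
    {X Y : TangentSpace I u.proj} (h : g u.proj X Y = 0) :
    sectional (completeLift g) u (tilt g u ε X) (tilt g u δ Y) =
      (1 / 4 * nablaSectional g u.proj u.snd X Y + (ε + δ) / 2 * sectional g u.proj X Y)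
        / (ε * δ) := by
  simp only [sectional, nablaSectional]
  rw [hg.completeLift_curvature_tilt, gram_tilt, gram, h]
  simp only [zero_mul, mul_zero, sub_zero, div_eq_mul_inv, mul_inv]
  ring

theorem IsPseudoRiemannianMetric.sectional_tilt_self (hg : IsPseudoRiemannianMetric I M g)
    (ε δ : ℝ) (X : TangentSpace I u.proj) :
    sectional (completeLift g) u (tilt g u ε X) (tilt g u δ X) = 0 := by
  have h1 : nablaCurvature g u.proj u.snd X X X = 0 :=
    nablaRiemann_self (E := E) _ _ _ _ _
  have h2 : curvature g u.proj X X X = 0 := riemann_self (E := E) _ _ _ _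
  rw [sectional, hg.completeLift_curvature_tilt, h1, h2]
  simp

end Adapted

end Norden

end

theorem mainTheorem11
    {E : Type*} [NormedAddCommGroup E] [NormedSpace ℝ E] [FiniteDimensional ℝ E]
    {H : Type*} [TopologicalSpace H] (I : ModelWithCorners ℝ E H) [I.Boundaryless]
    {M : Type*} [TopologicalSpace M] [ChartedSpace H M] [IsManifold I ∞ M]
    (J : Norden.EndField I M) (g : Norden.FormField I M) (hM : Norden.IsAlmostNorden I M J g)
    (u : TangentBundle I M) {n : ℕ}
    (e : Module.Basis (Fin n ⊕ Fin n) ℝ (TangentSpace I u.proj))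
    (he : Norden.IsOrthonormalJBasis J g u.proj e) :
    -- every basic 2-plane is non-degenerate
    (∀ A B, A ≠ B →
      Norden.gram (Norden.completeLift g) u
        (Norden.adapted g u e A) (Norden.adapted g u e B) ≠ 0) ∧
    -- the sectional curvatures of the basic 2-planes in terms of `k` and `∇_u k`
    (∀ a b, a ≠ b →
      Norden.sectional (Norden.completeLift g) u (Norden.xi g u (e a)) (Norden.xi g u (e b)) =
        1 / 4 * Norden.nablaSectional g u.proj u.snd (e a) (e b)
          + Norden.sectional g u.proj (e a) (e b) ∧
      Norden.sectional (Norden.completeLift g) u (Norden.xi g u (e a)) (Norden.eta g u (e b)) =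
        -(1 / 4) * Norden.nablaSectional g u.proj u.snd (e a) (e b) ∧
      Norden.sectional (Norden.completeLift g) u (Norden.eta g u (e a)) (Norden.eta g u (e b)) =
        1 / 4 * Norden.nablaSectional g u.proj u.snd (e a) (e b)
          - Norden.sectional g u.proj (e a) (e b)) ∧
    -- the `J₁`-holomorphic basic 2-planes are `{ξ_ī, η_i}` and `{η_ī, ξ_i}`
    (∀ A B, A ≠ B →
      (Norden.IsHolomorphic (Norden.J₁ J g u) (Norden.basicPlane g u e A B) ↔
        ∃ i, s(A, B) = s(Sum.inl (Sum.inr i), Sum.inr (Sum.inl i)) ∨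
          s(A, B) = s(Sum.inr (Sum.inr i), Sum.inl (Sum.inl i)))) ∧
    -- and their sectional curvatures are equal
    (∀ i,
      Norden.sectional (Norden.completeLift g) u
          (Norden.xi g u (e (Sum.inr i))) (Norden.eta g u (e (Sum.inl i))) =
        Norden.sectional (Norden.completeLift g) u
          (Norden.eta g u (e (Sum.inr i))) (Norden.xi g u (e (Sum.inl i)))) ∧
    -- the `J₂`-holomorphic basic 2-planes are `{η_i, ξ_i}` and `{η_ī, ξ_ī}`
    (∀ A B, A ≠ B →
      (Norden.IsHolomorphic (Norden.J₂ g u) (Norden.basicPlane g u e A B) ↔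
        ∃ a, s(A, B) = s(Sum.inr a, Sum.inl a))) ∧
    -- and their sectional curvatures vanish
    (∀ A B, A ≠ B →
      Norden.IsHolomorphic (Norden.J₂ g u) (Norden.basicPlane g u e A B) →
        Norden.sectional (Norden.completeLift g) u
          (Norden.adapted g u e A) (Norden.adapted g u e B) = 0) := by
  have hg := hM.metric
  refine ⟨fun A B h => he.gram_adapted_ne_zero h, fun a b h => ?_,
    fun A B _ => he.isHolomorphic_J₁_basicPlane_iff hM.almostComplex A B, fun i => ?_,
    fun A B _ => he.isHolomorphic_J₂_basicPlane_iff A B, fun A B _ h => ?_⟩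
  · have hab := he.orthogonal a b h
    simp only [Norden.xi_eq_tilt, Norden.eta_eq_tilt, hg.sectional_tilt _ _ hab]
    refine ⟨?_, ?_, ?_⟩ <;> ring
  · simp only [Norden.xi_eq_tilt, Norden.eta_eq_tilt,
      hg.sectional_tilt _ _ (he.orthogonal (Sum.inr i) (Sum.inl i) (by simp))]
    norm_num
  · obtain ⟨a, ha⟩ := (he.isHolomorphic_J₂_basicPlane_iff A B).1 h
    rw [Sym2.eq_iff] at ha
    rcases ha with ⟨rfl, rfl⟩ | ⟨rfl, rfl⟩ <;>
      simp only [Norden.adapted, Sum.elim_inl, Sum.elim_inr, Norden.xi_eq_tilt,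
        Norden.eta_eq_tilt] <;>
      exact hg.sectional_tilt_self _ _ _
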